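/- A family of subspaces $\{W_i\}_{i=1}^n$ of $\mathbb R^d$, with orthogonal projections $P_i$ onto $W_i$, is said to do phase retrieval on $\mathbb R^d$ if, whenever $x,y\in\mathbb R^d$ satisfy $\|P_ix\|=\|P_iy\|$ for all $i=1,\dots,n$, one has $x=y$ or $x=-y$. **Theorem.** There exist six hyperplanes $W_1,\dots,W_6\subset\mathbb R^4$ which do phase retrieval on $\mathbb R^4$. Explicitly, let $$\varphi_1=(2,-1,2,2),\quad \varphi_2=(2,5,4,1),\quad \varphi_3=(0,4,-1,-1),$$ $$\varphi_4=(5,4,-2,-4),\quad \varphi_5=(4,1,5,3),\quad \varphi_6=(3,-4,-4,-3),$$ and $W_j=\varphi_j^{\perp}\subset\mathbb R^4$ for $j=1,\dots,6$. Then $W_1,\dots,W_6$ are pairwise distinct, each $W_j$ has dimension $3$, and $\{W_j\}_{j=1}^6$ does phase retrieval on $\mathbb R^4$. -/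

import Mathlib

/-- A family of subspaces `W i` of `ℝ^d` (equivalently, the family of the orthogonal projections
`P i` onto them) does phase retrieval if `‖P i x‖ = ‖P i y‖` for all `i` implies `x = ± y`. -/
def DoesPhaseRetrieval {d : ℕ} {ι : Type*}
    (W : ι → Submodule ℝ (EuclideanSpace ℝ (Fin d))) : Prop :=
  ∀ x y : EuclideanSpace ℝ (Fin d),
    (∀ i, ‖(W i).starProjection x‖ = ‖(W i).starProjection y‖) → x = y ∨ x = -y

/-- Integer vectors spanning the lines orthogonal to the six hyperplanes. -/
noncomputable def phi : Fin 6 → EuclideanSpace ℝ (Fin 4) :=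
  ![!₂[2, -1, 2, 2],
    !₂[2, 5, 4, 1],
    !₂[0, 4, -1, -1],
    !₂[5, 4, -2, -4],
    !₂[4, 1, 5, 3],
    !₂[3, -4, -4, -3]]

/-- The orthogonal complement of `phi j` in `ℝ^4`. -/
noncomputable def phiPerp (j : Fin 6) : Submodule ℝ (EuclideanSpace ℝ (Fin 4)) :=
  (Submodule.span ℝ {phi j})ᗮ

/-!
Put `u = x - y` and `v = x + y`. By polarisation, `x` and `y` have the same norm of projection onto
the hyperplane `φᗮ` exactly when `‖φ‖² ⟪u, v⟫ = ⟪φ, u⟫ ⟪φ, v⟫`. This is a linear condition on the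
symmetric matrix `S = u vᵀ + v uᵀ`, and phase retrieval says that `S = 0` is the only matrix of this
shape that meets the six conditions.

The six conditions cut the ten-dimensional space of symmetric `4 × 4` matrices down to a
four-dimensional one, parametrised by `pencil` (`exists_eq_pencil`). A matrix `u vᵀ + v uᵀ` has rank
at most two, so its `3 × 3` minors vanish (`det_submatrix_symProd`). The locus of symmetric matrices
of rank at most two has codimension three and degree ten, hence it meets the projective three-space
of the pencil in ten complex points. For the given vectors these points form five pairs of complex
conjugates, none of them real. The absence of real points is certified by a combination of
the ten essentially different minors, with linear forms as coefficients, which is a positive definite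
sum of squares of quadratic forms in the parameters (`eq_zero_of_minors_pencil_eq_zero`). So `S = 0`,
which forces `u = 0` or `v = 0` (`eq_zero_or_eq_zero_of_symProd_eq_zero`).
-/

open scoped RealInnerProductSpace

/-! ### Hyperplane projections and polarisation -/

section Polarisation

variable {E : Type*} [NormedAddCommGroup E] [InnerProductSpace ℝ E]

theorem norm_sq_mul_norm_sq_starProjection_orthogonal_singleton (w x : E) :
    ‖w‖ ^ 2 * ‖(Submodule.span ℝ {w})ᗮ.starProjection x‖ ^ 2 =
      ‖w‖ ^ 2 * ‖x‖ ^ 2 - ⟪w, x⟫ ^ 2 := by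
  have h1 : ‖(Submodule.span ℝ {w})ᗮ.starProjection x‖ ^ 2 =
      ‖x‖ ^ 2 - ⟪(Submodule.span ℝ {w}).starProjection x, x⟫ := by
    rw [← real_inner_self_eq_norm_sq, ← Submodule.inner_starProjection_left_eq_right,
      Submodule.starProjection_eq_self_iff.2 (Submodule.starProjection_apply_mem _ _),
      Submodule.starProjection_orthogonal_val, inner_sub_left, real_inner_self_eq_norm_sq]
  have h2 := congrArg (fun z => ⟪z, x⟫) (Submodule.smul_starProjection_singleton ℝ (v := w) x)
  simp only [RCLike.ofReal_real_eq_id, id_eq, real_inner_smul_left] at h2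
  rw [h1]
  linear_combination -h2

theorem norm_sq_mul_inner_sub_add_of_norm_starProjection_eq {w x y : E}
    (h : ‖(Submodule.span ℝ {w})ᗮ.starProjection x‖ =
      ‖(Submodule.span ℝ {w})ᗮ.starProjection y‖) :
    ‖w‖ ^ 2 * ⟪x - y, x + y⟫ = ⟪w, x - y⟫ * ⟪w, x + y⟫ := by
  have hx := norm_sq_mul_norm_sq_starProjection_orthogonal_singleton w x
  have hy := norm_sq_mul_norm_sq_starProjection_orthogonal_singleton w y
  rw [h] at hx
  have hxy : ⟪x - y, x + y⟫ = ‖x‖ ^ 2 - ‖y‖ ^ 2 := by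
    simp only [inner_sub_left, inner_add_right, real_inner_self_eq_norm_sq, real_inner_comm x y]
    ring
  rw [hxy, inner_sub_right, inner_add_right]
  linear_combination hy - hx

end Polarisation

/-! ### Symmetric products of two vectors -/

theorem eq_zero_or_eq_zero_of_symProd_eq_zero {ι : Type*} {u v : ι → ℝ}
    (h : ∀ i j, u i * v j + u j * v i = 0) : u = 0 ∨ v = 0 := by
  by_contra! hne
  obtain ⟨k, hk⟩ := Function.ne_iff.1 hne.1
  have hvk : v k = 0 := by
    have := h k k
    exact (mul_eq_zero.1 (by linarith : u k * v k = 0)).resolve_left hk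
  refine hne.2 (funext fun j => ?_)
  have := h k j
  rw [hvk, mul_zero, add_zero] at this
  exact (mul_eq_zero.1 this).resolve_left hk

theorem det_submatrix_symProd {ι : Type*} (u v : ι → ℝ) (r c : Fin 3 → ι) :
    ((Matrix.of fun i j => u i * v j + u j * v i).submatrix r c).det = 0 := by
  simp only [Matrix.det_fin_three, Matrix.submatrix_apply, Matrix.of_apply]
  ring

/-! ### The pencil of symmetric matrices meeting the six conditions -/

/-- The general symmetric matrix `S` with `‖φ‖² tr S = φᵀ S φ` for each of the six vectors `φ`. The
four coefficient matrices are a reduced basis of the lattice of integer solutions. -/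
def pencil (a b c d : ℝ) : Matrix (Fin 4) (Fin 4) ℝ :=
  !![28 * a + 38 * b + 20 * c - 156 * d,
      -30 * a - 14 * b + 15 * c - 20 * d,
      27 * a + 28 * b - 52 * c + 46 * d,
      -29 * a - 14 * b + 56 * c - 49 * d;
    -30 * a - 14 * b + 15 * c - 20 * d,
      -16 * a - 2 * b - 32 * c - 100 * d,
      5 * a - 4 * b - 14 * c - 29 * d,
      -15 * a + 26 * b + 16 * c + 35 * d;
    27 * a + 28 * b - 52 * c + 46 * d,
      5 * a - 4 * b - 14 * c - 29 * d,
      10 * a - 56 * b + 12 * c + 18 * d,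
      -42 * a - 31 * b - 48 * c - 154 * d;
    -29 * a - 14 * b + 56 * c - 49 * d,
      -15 * a + 26 * b + 16 * c + 35 * d,
      -42 * a - 31 * b - 48 * c - 154 * d,
      -38 * a + 2 * b - 36 * c + 138 * d]

theorem exists_eq_pencil {u v : Fin 4 → ℝ}
    (h : ∀ j, (∑ i, phi j i ^ 2) * ∑ i, u i * v i =
      (∑ i, phi j i * u i) * ∑ i, phi j i * v i) :
    ∃ a b c d : ℝ, (Matrix.of fun i j => u i * v j + u j * v i) = pencil a b c d := by
  have h0 := h 0
  have h1 := h 1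
  have h2 := h 2
  have h3 := h 3
  have h4 := h 4
  have h5 := h 5
  simp only [phi, Fin.sum_univ_four, Matrix.cons_val] at h0 h1 h2 h3 h4 h5
  -- The parameters are recovered from four of the entries.
  refine ⟨(5150 * (u 0 * v 1 + u 1 * v 0) - 7423 * (u 1 * v 1 + u 1 * v 1) + 30335 * (u 1 * v 2
    + u 2 * v 1) + 6869 * (u 1 * v 3 + u 3 * v 1)) / 12908,
    (2548 * (u 0 * v 1 + u 1 * v 0) - 3640 * (u 1 * v 1 + u 1 * v 1) + 15610 * (u 1 * v 2
      + u 2 * v 1) + 3990 * (u 1 * v 3 + u 3 * v 1)) / 12908,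
    (8672 * (u 0 * v 1 + u 1 * v 0) - 11730 * (u 1 * v 1 + u 1 * v 1) + 47910 * (u 1 * v 2
      + u 2 * v 1) + 11138 * (u 1 * v 3 + u 3 * v 1)) / 12908,
    (-3650 * (u 0 * v 1 + u 1 * v 0) + 4885 * (u 1 * v 1 + u 1 * v 1) - 20497 * (u 1 * v 2
      + u 2 * v 1) - 4743 * (u 1 * v 3 + u 3 * v 1)) / 12908, ?_⟩
  ext i j
  fin_cases i <;> fin_cases j <;>
    simp only [pencil, Matrix.of_apply, Matrix.cons_val, Fin.zero_eta, Fin.mk_one,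
      Fin.reduceFinMk] <;>
    linarith

/-! ### The sum of squares certificate -/

set_option maxHeartbeats 2000000 in
/-- The pencil contains no nonzero real matrix of rank at most two. -/
theorem eq_zero_of_minors_pencil_eq_zero {a b c d : ℝ}
    (h : ∀ r s : Fin 3 → Fin 4, ((pencil a b c d).submatrix r s).det = 0) :
    a = 0 ∧ b = 0 ∧ c = 0 ∧ d = 0 := by
  have h00 := h ![0, 1, 2] ![0, 1, 2]
  have h01 := h ![0, 1, 2] ![0, 1, 3]
  have h02 := h ![0, 1, 2] ![0, 2, 3]
  have h03 := h ![0, 1, 2] ![1, 2, 3]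
  have h11 := h ![0, 1, 3] ![0, 1, 3]
  have h12 := h ![0, 1, 3] ![0, 2, 3]
  have h13 := h ![0, 1, 3] ![1, 2, 3]
  have h22 := h ![0, 2, 3] ![0, 2, 3]
  have h23 := h ![0, 2, 3] ![1, 2, 3]
  have h33 := h ![1, 2, 3] ![1, 2, 3]
  simp only [Matrix.det_fin_three, Matrix.submatrix_apply, pencil, Matrix.of_apply,
    Matrix.cons_val] at h00 h01 h02 h03 h11 h12 h13 h22 h23 h33
  -- Since the common zeros of the minors are nonreal, some quartic in the ideal of the minors has
  -- a positive definite Gram matrix on the ten quadratic monomials. The first ten squares are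
  -- a rounded Cholesky factorisation of such a matrix; the later ones, with the fourth powers,
  -- absorb the rounding error.
  obtain ⟨R, hR, hsum⟩ : ∃ R : ℝ, 0 ≤ R ∧
      14338985 * a ^ 4 + 15525302 * b ^ 4 + 13425893 * c ^ 4 + 15483036 * d ^ 4 + R = 0 := by
    refine ⟨121740 * (50 * a ^ 2 + 58 * a * b - 11 * a * c - 9 * a * d + 17 * b ^ 2
      - 10 * b * c - 4 * b * d - 7 * c ^ 2 + 5 * c * d + 5 * d ^ 2) ^ 2
      + 232249 * (50 * a * b + 3 * a * c - 4 * a * d + 39 * b ^ 2 - 2 * b * c - 13 * b * d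
        - c ^ 2 + 11 * c * d - d ^ 2) ^ 2
      + 198734 * (50 * a * c - 11 * a * d + 2 * b ^ 2 + 2 * b * c + 11 * b * d - 23 * c ^ 2
        + 14 * c * d - 9 * d ^ 2) ^ 2
      + 291891 * (50 * a * d - 6 * b ^ 2 + 8 * b * c + b * d + 15 * c ^ 2 - 7 * c * d + d ^ 2) ^ 2
      + 59008 * (50 * b ^ 2 + 15 * b * c + 2 * b * d - 23 * c ^ 2 - 7 * c * d - 5 * d ^ 2) ^ 2
      + 125904 * (50 * b * c + 4 * b * d + 28 * c ^ 2 - 9 * c * d + 2 * d ^ 2) ^ 2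
      + 205641 * (50 * b * d - 10 * c ^ 2 + c * d) ^ 2
      + 53113 * (50 * c ^ 2 + 59 * c * d - 15 * d ^ 2) ^ 2
      + 148432 * (50 * c * d + 11 * d ^ 2) ^ 2
      + 211058 * (50 * d ^ 2) ^ 2
      + 2559564 * (a ^ 2 + a * b) ^ 2
      + 1901252 * (a ^ 2 - a * c) ^ 2
      + 391608 * (a ^ 2 - a * d) ^ 2
      + 1502950 * (a ^ 2 + b * c) ^ 2
      + 3304553 * (a ^ 2 + b * d) ^ 2
      + 3071417 * (a * c - a * d) ^ 2
      + 634206 * (a * b + b ^ 2) ^ 2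
      + 754586 * (a * c + b ^ 2) ^ 2
      + 6179471 * (a * d + b ^ 2) ^ 2
      + 9527989 * (a * c + b * c) ^ 2
      + 5718953 * (a * b + c * d) ^ 2
      + 3117924 * (a * d + b * d) ^ 2
      + 4060009 * (a * c - c ^ 2) ^ 2
      + 1120763 * (a * d - c ^ 2) ^ 2
      + 4113599 * (a * d - c * d) ^ 2
      + 4673206 * (a * d + d ^ 2) ^ 2
      + 93809 * (b ^ 2 + b * c) ^ 2
      + 406427 * (b ^ 2 - b * d) ^ 2
      + 407006 * (b ^ 2 + c * d) ^ 2
      + 2476234 * (b * c + c ^ 2) ^ 2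
      + 1661385 * (b * d - c ^ 2) ^ 2
      + 3953816 * (b * d + c * d) ^ 2
      + 3095519 * (b * d + d ^ 2) ^ 2
      + 1254598 * (c ^ 2 + c * d) ^ 2
      + 747914 * (c * d - d ^ 2) ^ 2
      + 10464277 * (a * b) ^ 2
      + 8731138 * (a * c) ^ 2
      + 7369160 * (a * d) ^ 2
      + 10696514 * (b * c) ^ 2
      + 8273442 * (b * d) ^ 2
      + 6985300 * (c * d) ^ 2,
      by positivity, ?_⟩
    linear_combination
      (2476 * a + 3290 * b + 4550 * c - 952 * d) * h00
      + (3680 * a + 7632 * b + 1908 * c - 1598 * d) * h01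
      + (-10 * a + 6866 * b + 2886 * c - 474 * d) * h02
      + (-2342 * a + 2056 * b - 1444 * c - 106 * d) * h03
      + (716 * a + 4922 * b + 1906 * c - 312 * d) * h11
      + (-2738 * a - 502 * b - 6522 * c + 4578 * d) * h12
      + (2010 * a - 2454 * b - 754 * c + 770 * d) * h13
      + (1616 * a + 3796 * b - 1002 * c - 76 * d) * h22
      + (-2092 * a - 8238 * b + 446 * c + 802 * d) * h23
      + (62 * a + 1310 * b + 1134 * c - 618 * d) * h33
  have ha : 0 ≤ a ^ 4 := by positivity
  have hb : 0 ≤ b ^ 4 := by positivity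
  have hc : 0 ≤ c ^ 4 := by positivity
  have hd : 0 ≤ d ^ 4 := by positivity
  refine ⟨?_, ?_, ?_, ?_⟩ <;> refine pow_eq_zero_iff (n := 4) (by norm_num) |>.1 ?_ <;> linarith

theorem eq_zero_or_eq_zero_of_phi_conditions {u v : Fin 4 → ℝ}
    (h : ∀ j, (∑ i, phi j i ^ 2) * ∑ i, u i * v i =
      (∑ i, phi j i * u i) * ∑ i, phi j i * v i) : u = 0 ∨ v = 0 := by
  obtain ⟨a, b, c, d, hS⟩ := exists_eq_pencil h
  obtain ⟨rfl, rfl, rfl, rfl⟩ := eq_zero_of_minors_pencil_eq_zero (a := a) (b := b) (c := c)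
    (d := d) fun r s => hS ▸ det_submatrix_symProd u v r s
  refine eq_zero_or_eq_zero_of_symProd_eq_zero fun i j => ?_
  have hij := congrFun (congrFun hS i) j
  rw [Matrix.of_apply] at hij
  rw [hij]
  fin_cases i <;> fin_cases j <;> simp [pencil]

/-! ### Properties of the six hyperplanes -/

/-- The projections of the six vectors to the first two coordinates are pairwise linearly
independent. -/
theorem phi_mul_ne_phi_mul {i j : Fin 6} (hij : i ≠ j) :
    phi i 0 * phi j 1 ≠ phi i 1 * phi j 0 := by
  fin_cases i <;> fin_cases j <;> first | exact absurd rfl hij | norm_num [phi]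

theorem phi_ne_zero (j : Fin 6) : phi j ≠ 0 := by
  obtain ⟨i, hij⟩ := exists_ne j
  intro h
  exact phi_mul_ne_phi_mul hij (by simp [h])

theorem phiPerp_injective : Function.Injective phiPerp := by
  intro i j hij
  by_contra hne
  have hspan : Submodule.span ℝ {phi i} = Submodule.span ℝ {phi j} := by
    rw [← Submodule.orthogonal_orthogonal (Submodule.span ℝ {phi i}),
      ← Submodule.orthogonal_orthogonal (Submodule.span ℝ {phi j})]
    exact congrArg Submodule.orthogonal hij
  obtain ⟨c, hc⟩ := Submodule.mem_span_singleton.1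
    (hspan ▸ Submodule.mem_span_singleton_self (phi i))
  refine phi_mul_ne_phi_mul hne ?_
  rw [← hc]
  simp only [PiLp.smul_apply, smul_eq_mul]
  ring

theorem doesPhaseRetrieval_phiPerp : DoesPhaseRetrieval phiPerp := by
  intro x y hxy
  have key : ∀ j, (∑ i, phi j i ^ 2) * ∑ i, (x - y) i * (x + y) i =
      (∑ i, phi j i * (x - y) i) * ∑ i, phi j i * (x + y) i := by
    intro j
    have := norm_sq_mul_inner_sub_add_of_norm_starProjection_eq (hxy j)
    simpa only [EuclideanSpace.real_norm_sq_eq, PiLp.inner_apply, RCLike.inner_apply, conj_trivial,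
      mul_comm] using this
  rcases eq_zero_or_eq_zero_of_phi_conditions key with h | h
  · left
    exact sub_eq_zero.1 (PiLp.ext fun i => congrFun h i)
  · right
    exact eq_neg_of_add_eq_zero_left (PiLp.ext fun i => congrFun h i)

theorem mainTheorem4 :
    (∀ j : Fin 6, Module.finrank ℝ (phiPerp j) = 3) ∧
      Function.Injective phiPerp ∧
      DoesPhaseRetrieval phiPerp := by
  refine ⟨fun j => ?_, phiPerp_injective, doesPhaseRetrieval_phiPerp⟩
  have : Fact (Module.finrank ℝ (EuclideanSpace ℝ (Fin 4)) = 3 + 1) := ⟨by simp⟩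
  exact Submodule.finrank_orthogonal_span_singleton (phi_ne_zero j)
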